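/- Let $L$ be an even positive integer, $\beta=L^2$, let $M\ge 1$ be an integer, put $N'=L(M-1)$, and let $y$ be a non-zero complex number (for instance $|y|=1$). For an $L$-element set $\mathfrak u=\{\mathfrak u(1)<\dots<\mathfrak u(L)\}\subset[N')=\{0,1,\dots,N'-1\}$ put $$\delta\mathfrak u=\sum_{k=1}^L\mathfrak u(k)-\frac{L(N'-1)}2,\qquad \widetilde\Delta\mathfrak u=\prod_{1\le j<k\le L}\frac{\mathfrak u(k)-\mathfrak u(j)}{k-j},\qquad \mathbf e_{\mathfrak u}=\mathbf e_{\mathfrak u(1)}\wedge\dots\wedge\mathbf e_{\mathfrak u(L)}\in\Lambda^L\mathbb C^{N'},$$ where $\mathbf e_0,\dots,\mathbf e_{N'-1}$ is the standard basis of $\mathbb C^{N'}$. For $\omega\in\Lambda^L\mathbb C^{N'}$ let the hyperpfaffian $\mathrm{PF}(\omega)$ be the coefficient of $\mathbf e_0\wedge\dots\wedge\mathbf e_{N'-1}$ in $\omega^{\wedge(M-1)}/(M-1)!$. Then $$\mathrm{PF}\Bigl(\sum_{|\delta\mathfrak u|\le\beta/2}\binom{\beta}{\delta\mathfrak u+\beta/2}(-y)^{\delta\mathfrak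 u}\,\widetilde\Delta\mathfrak u\,\mathbf e_{\mathfrak u}\Bigr)=\frac1{(M-1)!}\binom{\beta M/2}{\beta/2,\dots,\beta/2},$$ or, in the normalisation with $(-y)^{\delta\mathfrak u+\beta/2}$ in place of $(-y)^{\delta\mathfrak u}$, $$\mathrm{PF}\Bigl(\sum_{|\delta\mathfrak u|\le\beta/2}\binom{\beta}{\delta\mathfrak u+\beta/2}(-y)^{\delta\mathfrak u+\beta/2}\,\widetilde\Delta\mathfrak u\,\mathbf e_{\mathfrak u}\Bigr)=\frac1{(M-1)!}\binom{\beta M/2}{\beta/2,\dots,\beta/2}\,y^{\beta(M-1)/2}.$$ Both sums are over all $L$-element $\mathfrak u\subset[N')$ with $|\delta\mathfrak u|\le\beta/2$, and the multinomial coefficient has $M$ lower entries, so that it equals $(\beta M/2)!/((\beta/2)!)^M$. -/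

import Mathlib

open scoped Nat

/-- The sum `Σ𝔱` of the elements of an `L`-element set `𝔱 ⊆ {0, …, N - 1}`. -/
def indexSum {N L : ℕ} (t : Set.powersetCard (Fin N) L) : ℤ :=
  ∑ k : Fin L, ((Set.powersetCard.ofFinEmbEquiv.symm t k : ℕ) : ℤ)

/-- `δ𝔱 = Σ𝔱 - L (N - 1) / 2`. The division is exact when `L` is even. -/
def centredSum {N L : ℕ} (t : Set.powersetCard (Fin N) L) : ℤ :=
  indexSum t - (L : ℤ) * ((N : ℤ) - 1) / 2

/-- The normalised Vandermonde product `∏_{j < k} (𝔱(k) - 𝔱(j)) / (k - j)`, where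
`𝔱(0) < 𝔱(1) < ⋯ < 𝔱(L - 1)` are the elements of `𝔱`. -/
noncomputable def normVandermonde {N L : ℕ} (t : Set.powersetCard (Fin N) L) : ℂ :=
  ∏ k : Fin L, ∏ j ∈ Finset.Iio k,
    (((Set.powersetCard.ofFinEmbEquiv.symm t k : ℕ) : ℂ) -
        ((Set.powersetCard.ofFinEmbEquiv.symm t j : ℕ) : ℂ)) /
      (((k : ℕ) : ℂ) - ((j : ℕ) : ℂ))

/-- The basis `L`-vector `e_𝔱 = e_{𝔱(0)} ∧ ⋯ ∧ e_{𝔱(L - 1)}` of `Λ^L ℂ^N`. -/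
noncomputable def basisBlade {N L : ℕ} (t : Set.powersetCard (Fin N) L) :
    ⋀[ℂ]^L (Fin N → ℂ) :=
  exteriorPower.ιMulti_family ℂ L (Pi.basisFun ℂ (Fin N)) t

/-- The coefficient of the volume form `e_0 ∧ ⋯ ∧ e_{N - 1}` in an element of the exterior algebra
of `ℂ^N`; on `Λ^N ℂ^N` this is the Hodge star `Λ^N ℂ^N → Λ^0 ℂ^N = ℂ`. -/
noncomputable def volumeCoeff {N : ℕ} (α : ExteriorAlgebra ℂ (Fin N → ℂ)) : ℂ :=
  (Pi.basisFun ℂ (Fin N)).ExteriorAlgebra.repr α Finset.univ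

/-- The hyperpfaffian `PF(ω) = ∗ (ω^{∧K} / K!)` of an `L`-vector `ω` over `ℂ^{LK}`. -/
noncomputable def hyperpfaffian (L K : ℕ) (ω : ⋀[ℂ]^L (Fin (L * K) → ℂ)) : ℂ :=
  volumeCoeff (((K ! : ℂ)⁻¹) • (ω : ExteriorAlgebra ℂ (Fin (L * K) → ℂ)) ^ K)

/-! Write β = L² and K = M - 1. The wedge of the first L divided derivatives of the moment curve at
x is ∑ x^(`excess` u) Δ̃u e_u (`ιMulti_osculatingVector`). Wedging K of these, at x_1, …, x_K, gives
a confluent Vandermonde determinant, ∏_{i<j} (x_j - x_i)^β (`volumeCoeffProd_osculating`).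

The binomial weight of u is the coefficient of X^(Kβ/2) in X^(`excess` u) (X - y)^β. By
multilinearity, K! PF is therefore the coefficient of ∏ x_i^(Kβ/2) in ∏_{i<j} (x_j - x_i)^β ∏ (x_i -
y)^β (`multilinearMap_coeff_eq`). That polynomial is the Dyson product in K + 1 variables with one
of them set to y, so homogeneity and Dyson's constant term identity give y^(Kβ/2) times the
multinomial coefficient. The unshifted normalisation follows because PF is homogeneous of degree K.
-/

/-! ### Dyson's constant term identity, by Good's proof. -/

section Dyson

open MvPolynomial

variable {σ R : Type*} [DecidableEq σ] [CommRing R]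

/-- The polynomial `∏_{i ≠ j} (X_i - X_j) ^ a_j` whose coefficients are those of the Dyson product
`∏_{i ≠ j} (1 - X_j / X_i) ^ a_j`. -/
noncomputable def dysonPoly (R : Type*) [CommRing R] (s : Finset σ) (a : σ → ℕ) :
    MvPolynomial σ R :=
  ∏ j ∈ s, (∏ i ∈ s.erase j, (X i - X j)) ^ a j

/-- Only the X_k part of each factor can raise the degree in X_k, so the leading coefficient in X_k
is merely shifted. -/
theorem degreeOf_le_and_coeff_mul_X_sub_X [Nontrivial R] {k j : σ} (hjk : j ≠ k) {m : σ →₀ ℕ}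
    (hm : m k = 0) {Q : MvPolynomial σ R} {d : ℕ} (hQ : degreeOf k Q ≤ d) (n : ℕ) :
    degreeOf k (Q * (X k - X j) ^ n) ≤ d + n ∧
      coeff (m + Finsupp.single k (d + n)) (Q * (X k - X j) ^ n) =
        coeff (m + Finsupp.single k d) Q := by
  have hX : degreeOf k (X k - X j : MvPolynomial σ R) ≤ 1 := by
    refine (degreeOf_sub_le _ _ _).trans ?_
    simp [degreeOf_X, hjk.symm]
  induction n with
  | zero => simpa using hQ
  | succ n ih =>
    obtain ⟨h1, h2⟩ := ih
    rw [pow_succ, ← mul_assoc]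
    refine ⟨(degreeOf_mul_le _ _ _).trans (by omega), ?_⟩
    rw [mul_sub, coeff_sub, ← h2, ← add_assoc d n 1, Finsupp.single_add, ← add_assoc m,
      coeff_mul_X, sub_eq_self]
    by_contra h
    have h3 := monomial_le_degreeOf k (mem_support_iff.2 h)
    have h4 := degreeOf_mul_le k (Q * (X k - X j) ^ n) (X j : MvPolynomial σ R)
    simp [degreeOf_X, hjk.symm, hm] at h3 h4
    omega

theorem coeff_mul_prod_X_sub_X_pow [Nontrivial R] {k : σ} {m : σ →₀ ℕ} (hm : m k = 0)
    {Q : MvPolynomial σ R} (hQ : degreeOf k Q = 0) (a : σ → ℕ) (t : Finset σ) (ht : k ∉ t) :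
    degreeOf k (Q * ∏ j ∈ t, (X k - X j) ^ a j) ≤ ∑ j ∈ t, a j ∧
      coeff (m + Finsupp.single k (∑ j ∈ t, a j)) (Q * ∏ j ∈ t, (X k - X j) ^ a j) =
        coeff m Q := by
  induction t using Finset.induction_on with
  | empty => simp [hQ]
  | insert j t hj ih =>
    rw [Finset.mem_insert, not_or] at ht
    obtain ⟨h1, h2⟩ := ih ht.2
    have := degreeOf_le_and_coeff_mul_X_sub_X (Ne.symm ht.1) hm h1 (a j)
    rw [Finset.prod_insert hj, Finset.sum_insert hj, mul_comm (_ ^ _), ← mul_assoc, add_comm (a j),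
      ← h2]
    exact this

theorem dysonPoly_of_eq_zero {s : Finset σ} {a : σ → ℕ} {k : σ} (hk : k ∈ s) (ha : a k = 0) :
    dysonPoly R s a = dysonPoly R (s.erase k) a * ∏ j ∈ s.erase k, (X k - X j) ^ a j := by
  rw [dysonPoly, dysonPoly, ← Finset.mul_prod_erase s _ hk, ha, pow_zero, one_mul,
    ← Finset.prod_mul_distrib]
  refine Finset.prod_congr rfl fun j hj => ?_
  rw [← mul_pow, Finset.erase_right_comm, Finset.prod_erase_mul]
  simp [hk, (Finset.ne_of_mem_erase hj).symm]

theorem degreeOf_dysonPoly_of_notMem [Nontrivial R] {s : Finset σ} (a : σ → ℕ) {k : σ}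
    (hk : k ∉ s) : degreeOf k (dysonPoly R s a) = 0 := by
  have hX : ∀ i ∈ s, degreeOf k (X i : MvPolynomial σ R) = 0 := fun i hi => by
    rw [degreeOf_X, if_neg]
    rintro rfl
    exact hk hi
  rw [← Nat.le_zero, dysonPoly]
  refine (degreeOf_prod_le _ _ _).trans (Finset.sum_nonpos fun j hj => ?_)
  refine (degreeOf_pow_le _ _ _).trans (Nat.le_zero.2 (mul_eq_zero_of_right _ ?_))
  rw [← Nat.le_zero]
  refine (degreeOf_prod_le _ _ _).trans (Finset.sum_nonpos fun i hi => ?_)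
  refine (degreeOf_sub_le _ _ _).trans ?_
  rw [hX j hj, hX i (Finset.mem_of_mem_erase hi)]
  rfl

/-- Lagrange interpolation of the constant `1` at the nodes `v`, evaluated at zero. -/
theorem prod_prod_erase_sub_eq_sum {F : Type*} [Field F] {s : Finset σ} (hs : s.Nonempty)
    {v : σ → F} (hv : Set.InjOn v s) :
    ∏ j ∈ s, ∏ i ∈ s.erase j, (v i - v j) =
      ∑ j ∈ s, (∏ i ∈ s.erase j, v i) * ∏ l ∈ s.erase j, ∏ i ∈ s.erase l, (v i - v l) := by
  have h := congrArg (Polynomial.eval 0) (Lagrange.sum_basis hv hs)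
  rw [Polynomial.eval_finsetSum, Polynomial.eval_one] at h
  rw [← mul_one (∏ j ∈ s, ∏ i ∈ s.erase j, (v i - v j)), ← h, Finset.mul_sum]
  refine Finset.sum_congr rfl fun j hj => ?_
  rw [← Finset.mul_prod_erase s _ hj, Lagrange.basis, Polynomial.eval_prod, mul_right_comm,
    ← Finset.prod_mul_distrib]
  congr 1
  refine Finset.prod_congr rfl fun i hi => ?_
  have : v i - v j ≠ 0 := sub_ne_zero.2 fun h =>
    Finset.ne_of_mem_erase hi (hv (Finset.mem_of_mem_erase hi) hj h)
  have h' : v j - v i ≠ 0 := by rwa [← neg_sub, neg_ne_zero]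
  simp only [Lagrange.basisDivisor, Polynomial.eval_mul, Polynomial.eval_C, Polynomial.eval_sub,
    Polynomial.eval_X]
  field_simp
  ring

/-- Good's recursion: when every exponent is positive, one copy of ∏_{i≠j} (X_i - X_j) splits off,
and Lagrange interpolation at the distinct nodes X_i expands it. -/
theorem dysonPoly_eq_sum [IsDomain R] {s : Finset σ} (hs : s.Nonempty) {a : σ → ℕ}
    (ha : ∀ j ∈ s, a j ≠ 0) :
    dysonPoly R s a =
      ∑ j ∈ s, (∏ i ∈ s.erase j, X i) * dysonPoly R s (Function.update a j (a j - 1)) := by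
  have key : (∏ j ∈ s, ∏ i ∈ s.erase j, (X i - X j : MvPolynomial σ R)) =
      ∑ j ∈ s, (∏ i ∈ s.erase j, X i) * ∏ l ∈ s.erase j, ∏ i ∈ s.erase l, (X i - X l) := by
    apply IsFractionRing.injective (MvPolynomial σ R) (FractionRing (MvPolynomial σ R))
    simp only [map_prod, map_sum, map_mul, map_sub]
    exact prod_prod_erase_sub_eq_sum hs
      (((IsFractionRing.injective (MvPolynomial σ R) _).comp (X_injective)).injOn)
  have h1 : dysonPoly R s a = (∏ j ∈ s, ∏ i ∈ s.erase j, (X i - X j)) *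
      ∏ j ∈ s, (∏ i ∈ s.erase j, (X i - X j)) ^ (a j - 1) := by
    rw [← Finset.prod_mul_distrib]
    refine Finset.prod_congr rfl fun j hj => ?_
    rw [← pow_succ', Nat.sub_add_cancel (Nat.one_le_iff_ne_zero.2 (ha j hj))]
  rw [h1, key, Finset.sum_mul]
  refine Finset.sum_congr rfl fun j hj => ?_
  rw [mul_assoc, dysonPoly]
  congr 1
  rw [← Finset.mul_prod_erase s _ hj, ← Finset.mul_prod_erase s (fun l => _ ^ _) hj,
    Function.update_self, mul_left_comm, ← Finset.prod_mul_distrib]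
  congr 1
  refine Finset.prod_congr rfl fun l hl => ?_
  rw [Function.update_of_ne (Finset.ne_of_mem_erase hl), ← pow_succ',
    Nat.sub_add_cancel (Nat.one_le_iff_ne_zero.2 (ha l (Finset.mem_of_mem_erase hl)))]

/-- **Dyson's constant term identity**, with the denominators cleared. -/
theorem coeff_dysonPoly_mul_prod_factorial [IsDomain R] (s : Finset σ) (a : σ → ℕ)
    (m : σ →₀ ℕ) (hm : ∀ k, m k = if k ∈ s then ∑ j ∈ s.erase k, a j else 0) :
    coeff m (dysonPoly R s a) * ∏ j ∈ s, ((a j)! : R) = ((∑ j ∈ s, a j)! : R) := by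
  induction hn : s.card + ∑ j ∈ s, a j using Nat.strong_induction_on generalizing s a m with
  | _ n ih =>
  subst hn
  rcases s.eq_empty_or_nonempty with rfl | hs
  · have : m = 0 := by ext k; simp [hm]
    simp [dysonPoly, this]
  by_cases h0 : ∃ k ∈ s, a k = 0
  -- If a_k = 0, then m k is the largest possible degree in X_k, and taking the leading coefficient
  -- in X_k removes the index k.
  · obtain ⟨k, hk, hak⟩ := h0
    have hsum : ∑ j ∈ s, a j = ∑ j ∈ s.erase k, a j := by
      rw [← Finset.add_sum_erase s a hk, hak, zero_add]
    have hm' : m = m.erase k + Finsupp.single k (∑ j ∈ s.erase k, a j) := by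
      conv_lhs => rw [← Finsupp.erase_add_single k m, hm k, if_pos hk]
    rw [dysonPoly_of_eq_zero hk hak, hm', (coeff_mul_prod_X_sub_X_pow (by simp)
      (degreeOf_dysonPoly_of_notMem a (Finset.notMem_erase k s)) a _
      (Finset.notMem_erase k s)).2, hsum, ← Finset.mul_prod_erase s _ hk, hak,
      Nat.factorial_zero, Nat.cast_one, one_mul]
    refine ih _ ?_ (s.erase k) a _ (fun i => ?_) rfl
    · have := Finset.card_erase_lt_of_mem hk
      omega
    · by_cases hik : i = k
      · simp [hik]
      · rw [Finsupp.erase_ne hik, hm i]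
        by_cases his : i ∈ s
        · rw [if_pos his, if_pos (Finset.mem_erase.2 ⟨hik, his⟩), Finset.erase_right_comm,
            ← Finset.add_sum_erase (s.erase i) a (Finset.mem_erase.2 ⟨Ne.symm hik, hk⟩), hak,
            zero_add]
        · rw [if_neg his, if_neg fun h => his (Finset.mem_of_mem_erase h)]
  · push Not at h0
    have hterm : ∀ j ∈ s, coeff m ((∏ i ∈ s.erase j, X i) *
        dysonPoly R s (Function.update a j (a j - 1))) * ∏ i ∈ s, ((a i)! : R) =
        (a j : R) * ((∑ i ∈ s, a i - 1)! : R) := by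
      intro j hj
      set a' := Function.update a j (a j - 1) with ha'
      have hsum' : ∑ i ∈ s, a' i = ∑ i ∈ s, a i - 1 := by
        rw [← Finset.add_sum_erase s a' hj, ← Finset.add_sum_erase s a hj, ha',
          Function.update_self, Finset.sum_congr rfl fun i hi =>
            Function.update_of_ne (Finset.ne_of_mem_erase hi) _ _]
        have := h0 j hj
        omega
      have hpos : 0 < ∑ i ∈ s, a i :=
        (Nat.pos_of_ne_zero (h0 j hj)).trans_le (Finset.single_le_sum (fun _ _ => Nat.zero_le _) hj)
      have hfac : ∏ i ∈ s, ((a i)! : R) = a j * ∏ i ∈ s, ((a' i)! : R) := by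
        rw [← Finset.mul_prod_erase s _ hj, ← Finset.mul_prod_erase s (fun i => ((a' i)! : R)) hj,
          ← mul_assoc, ha', Function.update_self, ← Nat.cast_mul,
          Nat.mul_factorial_pred (h0 j hj)]
        congr 1
        exact Finset.prod_congr rfl fun i hi => by
          rw [Function.update_of_ne (Finset.ne_of_mem_erase hi)]
      let m' : σ →₀ ℕ := Finsupp.indicator s fun i _ => ∑ l ∈ s.erase i, a' l
      have hm' : ∀ k, m' k = if k ∈ s then ∑ l ∈ s.erase k, a' l else 0 := fun k => by
        simp [m', Finsupp.indicator_apply]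
      -- Lowering a_j by one lowers every target exponent except the j-th by one, exactly the
      -- monomial in Good's recursion.
      have hmm : m = (∑ i ∈ s.erase j, Finsupp.single i 1) + m' := by
        ext k
        rw [Finsupp.add_apply, hm, hm', Finsupp.finsetSum_apply]
        by_cases hk : k ∈ s
        · rw [if_pos hk, if_pos hk]
          simp only [Finsupp.single_apply]
          rw [Finset.sum_ite_eq']
          by_cases hkj : k = j
          · subst hkj
            rw [if_neg (Finset.notMem_erase _ _), zero_add]
            exact Finset.sum_congr rfl fun i hi => by
              rw [ha', Function.update_of_ne (Finset.ne_of_mem_erase hi)]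
          · have hj' : j ∈ s.erase k := Finset.mem_erase.2 ⟨Ne.symm hkj, hj⟩
            have hrest : ∑ i ∈ (s.erase k).erase j, a' i = ∑ i ∈ (s.erase k).erase j, a i :=
              Finset.sum_congr rfl fun i hi => by
                rw [ha', Function.update_of_ne (Finset.ne_of_mem_erase hi)]
            rw [if_pos (Finset.mem_erase.2 ⟨hkj, hk⟩), ← Finset.add_sum_erase _ a hj',
              ← Finset.add_sum_erase _ a' hj', hrest, ha', Function.update_self]
            have := h0 j hj
            omega
        · rw [if_neg hk, if_neg hk, add_zero, eq_comm]
          refine Finset.sum_eq_zero fun i hi => Finsupp.single_eq_of_ne ?_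
          rintro rfl
          exact hk (Finset.mem_of_mem_erase hi)
      have hX : (∏ i ∈ s.erase j, X i : MvPolynomial σ R) =
          monomial (∑ i ∈ s.erase j, Finsupp.single i 1) 1 := by
        rw [monomial_sum_one]
        rfl
      rw [hX, hmm, coeff_monomial_mul, one_mul, hfac, mul_left_comm,
        ih _ (by omega) s a' m' hm' rfl, hsum']
    rw [dysonPoly_eq_sum hs h0, coeff_sum, Finset.sum_mul, Finset.sum_congr rfl hterm,
      ← Finset.sum_mul, ← Nat.cast_sum, ← Nat.cast_mul, Nat.mul_factorial_pred]
    obtain ⟨j, hj⟩ := hs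
    exact ((Nat.pos_of_ne_zero (h0 j hj)).trans_le
      (Finset.single_le_sum (fun _ _ => Nat.zero_le _) hj)).ne'

end Dyson
-- The confluent Vandermonde determinant.
section ConfluentVandermonde

open Polynomial

variable {R : Type*} [CommRing R]

/-- The Newton basis polynomial of degree `r` for the nodes `x 0, x 1, …`, each repeated
`L` times. -/
noncomputable def confluentNewton (L : ℕ) (x : ℕ → R) (r : ℕ) : R[X] :=
  (∏ i ∈ Finset.range (r / L), (X - C (x i)) ^ L) * (X - C (x (r / L))) ^ (r % L)

theorem monic_confluentNewton (L : ℕ) (x : ℕ → R) (r : ℕ) : (confluentNewton L x r).Monic :=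
  (monic_prod_of_monic _ _ fun i _ => (monic_X_sub_C (x i)).pow L).mul ((monic_X_sub_C _).pow _)

theorem natDegree_confluentNewton [Nontrivial R] (L : ℕ) (x : ℕ → R) (r : ℕ) :
    (confluentNewton L x r).natDegree = r := by
  rw [confluentNewton, (monic_prod_of_monic _ _ fun i _ => (monic_X_sub_C (x i)).pow L).natDegree_mul
    ((monic_X_sub_C _).pow _), natDegree_prod_of_monic _ _ fun i _ => (monic_X_sub_C (x i)).pow L]
  simp only [(monic_X_sub_C _).natDegree_pow, natDegree_X_sub_C, Finset.sum_const,
    Finset.card_range, smul_eq_mul, mul_one]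
  rw [mul_comm, Nat.div_add_mod]

theorem coeff_taylor_X_sub_C_pow_mul (x : R) (q : R[X]) (e l : ℕ) :
    (taylor x ((X - C x) ^ e * q)).coeff l = if e ≤ l then (taylor x q).coeff (l - e) else 0 := by
  rw [taylor_mul, taylor_pow, map_sub, taylor_X, taylor_C, add_sub_cancel_right, coeff_X_pow_mul']

theorem prod_range_mul_comp_div {M : Type*} [CommMonoid M] {L : ℕ} (hL : 0 < L) (K : ℕ)
    (f : ℕ → M) : ∏ r ∈ Finset.range (L * K), f (r / L) = ∏ i ∈ Finset.range K, f i ^ L := by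
  induction K with
  | zero => simp
  | succ K ih =>
    have h : ∀ l ∈ Finset.range L, f ((L * K + l) / L) = f K := fun l hl => by
      rw [Nat.mul_add_div hL, Nat.div_eq_of_lt (Finset.mem_range.1 hl), add_zero]
    rw [Nat.mul_succ, Finset.prod_range_add, ih, Finset.prod_range_succ, Finset.prod_congr rfl h,
      Finset.prod_const, Finset.card_range]

/-- The determinant of the confluent Vandermonde matrix, with `L` rows for each of `K` nodes. -/
theorem det_confluentVandermonde [Nontrivial R] {L : ℕ} (hL : 0 < L) (K : ℕ) (x : ℕ → R) :
    (Matrix.of fun r n : Fin (L * K) => ((n : ℕ).choose (r % L) : R) * x (r / L) ^ (n - r % L : ℕ)).det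
      = ∏ k ∈ Finset.range K, ∏ i ∈ Finset.range k, (x k - x i) ^ L ^ 2 := by
  set A := Matrix.of fun r n : Fin (L * K) =>
    ((n : ℕ).choose (r % L) : R) * x (r / L) ^ (n - r % L : ℕ) with hA
  -- Passing from monomials to the monic Newton basis is a column operation of determinant 1. The
  -- new entries are Taylor coefficients, which vanish above the diagonal by divisibility.
  have hmul : A * (Matrix.of fun n j : Fin (L * K) => (confluentNewton L x j).coeff n) =
      Matrix.of fun r j : Fin (L * K) =>
        (taylor (x (r / L)) (confluentNewton L x j)).coeff (r % L) := by
    ext r j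
    rw [Matrix.mul_apply]
    conv_rhs => rw [Matrix.of_apply, (confluentNewton L x j).as_sum_range_C_mul_X_pow'
      (n := L * K) (by rw [natDegree_confluentNewton]; exact j.2)]
    rw [map_sum, finsetSum_coeff, Finset.sum_range]
    refine Finset.sum_congr rfl fun n _ => ?_
    rw [taylor_mul, taylor_C, taylor_X_pow, coeff_C_mul, coeff_X_add_C_pow, hA, Matrix.of_apply,
      Matrix.of_apply]
    ring
  have hdet := Matrix.det_matrixOfPolynomials (fun j : Fin (L * K) => confluentNewton L x j)
    (fun j => natDegree_confluentNewton L x j) (fun j => monic_confluentNewton L x j)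
  rw [← mul_one A.det, ← hdet, ← Matrix.det_mul, hmul, Matrix.det_of_isLowerTriangular]
  · have hdiag : ∀ r : ℕ, (taylor (x (r / L)) (confluentNewton L x r)).coeff (r % L) =
        ∏ i ∈ Finset.range (r / L), (x (r / L) - x i) ^ L := fun r => by
      rw [confluentNewton, mul_comm, coeff_taylor_X_sub_C_pow_mul, if_pos le_rfl, Nat.sub_self,
        taylor_coeff_zero, eval_prod]
      simp
    simp only [Matrix.of_apply, hdiag]
    rw [Finset.prod_fin_eq_prod_range]
    trans ∏ r ∈ Finset.range (L * K), ∏ i ∈ Finset.range (r / L), (x (r / L) - x i) ^ L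
    · exact Finset.prod_congr rfl fun r hr => by rw [dif_pos (Finset.mem_range.1 hr)]
    · rw [prod_range_mul_comp_div hL K fun k => ∏ i ∈ Finset.range k, (x k - x i) ^ L]
      refine Finset.prod_congr rfl fun k _ => ?_
      rw [← Finset.prod_pow]
      exact Finset.prod_congr rfl fun i _ => by rw [← pow_mul, sq]
  · intro r j hrj
    have hrj : (r : ℕ) < j := hrj
    rw [Matrix.of_apply]
    rcases (Nat.div_le_div_right hrj.le : (r : ℕ) / L ≤ j / L).lt_or_eq with h | h
    · rw [confluentNewton, ← Finset.mul_prod_erase _ _ (Finset.mem_range.2 h), mul_assoc,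
        coeff_taylor_X_sub_C_pow_mul, if_neg (Nat.mod_lt _ hL).not_ge]
    · rw [confluentNewton, mul_comm (Finset.prod _ _), ← h, coeff_taylor_X_sub_C_pow_mul, if_neg]
      have h1 := Nat.div_add_mod (r : ℕ) L
      have h2 := Nat.div_add_mod (j : ℕ) L
      rw [← h] at h2
      omega

end ConfluentVandermonde

/-! ### Minors of binomial matrices and osculating blades. -/

section Minors

variable {R : Type*} [CommRing R]

/-- Falling factorials are monic, so they may replace powers in the Vandermonde matrix; each is a
factorial times a binomial. -/
theorem det_vandermonde_natCast_eq [IsDomain R] (n : ℕ) (v : Fin n → ℕ) :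
    (Matrix.vandermonde fun i => (v i : R)).det =
      (∏ i : Fin n, ((i : ℕ)! : R)) * (Matrix.of fun i j : Fin n => ((v i).choose j : R)).det := by
  rw [Matrix.det_eval_matrixOfPolynomials_eq_det_vandermonde _ (fun i : Fin n => descPochhammer R i)
    (fun i => descPochhammer_natDegree R i) (fun i => monic_descPochhammer R i),
    ← Matrix.det_mul_row]
  congr 1
  ext i j
  simp only [Matrix.of_apply]
  rw [descPochhammer_eval_eq_descFactorial, Nat.descFactorial_eq_factorial_mul_choose,
    Nat.cast_mul]

theorem det_choose_val (n : ℕ) :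
    (Matrix.of fun i j : Fin n => ((i : ℕ).choose j : R)).det = 1 := by
  rw [Matrix.det_of_isLowerTriangular]
  · simp
  · intro i j hij
    rw [Matrix.of_apply, Nat.choose_eq_zero_of_lt (show (i : ℕ) < j from hij), Nat.cast_zero]

theorem normVandermonde_eq_det {N L : ℕ} (t : Set.powersetCard (Fin N) L) :
    normVandermonde t = (Matrix.of fun k l : Fin L =>
      (((Set.powersetCard.ofFinEmbEquiv.symm t k : ℕ).choose l : ℕ) : ℂ)).det := by
  have hswap : ∀ f : Fin L → Fin L → ℂ,
      ∏ k, ∏ j ∈ Finset.Iio k, f j k = ∏ j, ∏ k ∈ Finset.Ioi j, f j k := fun f =>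
    Finset.prod_comm' (by simp)
  have hfac : (∏ i : Fin L, ((i : ℕ)! : ℂ)) ≠ 0 :=
    Finset.prod_ne_zero_iff.2 fun i _ => Nat.cast_ne_zero.2 (Nat.factorial_ne_zero _)
  have h1 := det_vandermonde_natCast_eq (R := ℂ) L fun k =>
    (Set.powersetCard.ofFinEmbEquiv.symm t k : ℕ)
  have h2 := det_vandermonde_natCast_eq (R := ℂ) L fun k => (k : ℕ)
  rw [Matrix.det_vandermonde] at h1 h2
  rw [det_choose_val, mul_one] at h2
  simp only [normVandermonde, Finset.prod_div_distrib]
  rw [hswap fun j k => ((Set.powersetCard.ofFinEmbEquiv.symm t k : ℕ) : ℂ) -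
    ((Set.powersetCard.ofFinEmbEquiv.symm t j : ℕ) : ℂ), hswap fun j k => ((k : ℕ) : ℂ) - j,
    h1, h2, mul_div_cancel_left₀ _ hfac]

/-- All nonzero Leibniz terms carry the same power of x; wherever a subtraction would truncate, the
binomial is zero. -/
theorem det_choose_mul_pow {n : ℕ} (v : Fin n → ℕ) (x : R) :
    (Matrix.of fun k l : Fin n => ((v k).choose l : R) * x ^ (v k - l)).det =
      x ^ (∑ k, v k - ∑ l : Fin n, (l : ℕ)) *
        (Matrix.of fun k l : Fin n => ((v k).choose l : R)).det := by
  rw [Matrix.det_apply, Matrix.det_apply, Finset.mul_sum]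
  refine Finset.sum_congr rfl fun σ _ => ?_
  rw [mul_smul_comm]
  congr 1
  simp only [Matrix.of_apply]
  by_cases h : ∀ l : Fin n, (l : ℕ) ≤ v (σ l)
  · rw [Finset.prod_mul_distrib, Finset.prod_pow_eq_pow_sum,
      Finset.sum_tsub_distrib _ fun l _ => h l, Equiv.sum_comp σ v, mul_comm]
  · push Not at h
    obtain ⟨l, hl⟩ := h
    rw [Finset.prod_eq_zero (Finset.mem_univ l), Finset.prod_eq_zero (Finset.mem_univ l), mul_zero]
    · rw [Nat.choose_eq_zero_of_lt hl, Nat.cast_zero]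
    · rw [Nat.choose_eq_zero_of_lt hl, Nat.cast_zero, zero_mul]

/-- The nonnegative integer `Σ𝔱 - L (L - 1) / 2`. -/
def excess {N L : ℕ} (t : Set.powersetCard (Fin N) L) : ℕ :=
  ∑ k : Fin L, (Set.powersetCard.ofFinEmbEquiv.symm t k : ℕ) - ∑ l : Fin L, (l : ℕ)

/-- The `l`-th divided derivative at `x` of the moment curve `(1, x, …, x ^ (N - 1))`. -/
noncomputable def osculatingVector (N : ℕ) (x : ℂ) (l : ℕ) : Fin N → ℂ :=
  fun n => ((n : ℕ).choose l : ℂ) * x ^ ((n : ℕ) - l)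

theorem ιMulti_osculatingVector (N L : ℕ) (x : ℂ) :
    exteriorPower.ιMulti ℂ L (fun l : Fin L => osculatingVector N x l) =
      ∑ u : Set.powersetCard (Fin N) L, x ^ excess u • normVandermonde u • basisBlade u := by
  conv_lhs => rw [← ((Pi.basisFun ℂ (Fin N)).exteriorPower L).sum_repr
    (exteriorPower.ιMulti ℂ L (fun l : Fin L => osculatingVector N x l))]
  refine Finset.sum_congr rfl fun u _ => ?_
  rw [exteriorPower.basis_apply, exteriorPower.basis_repr_apply,
    exteriorPower.ιMultiDual_apply_ιMulti, smul_smul, basisBlade]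
  congr 1
  rw [normVandermonde_eq_det, excess, ← det_choose_mul_pow, ← Matrix.det_transpose]
  rfl

end Minors
-- Volume coefficients of wedge products.
section Wedge

/-- An alternating map of top degree is determined by its value on one basis. -/
theorem volumeCoeff_ιMulti (N : ℕ) (w : Fin N → Fin N → ℂ) :
    volumeCoeff (ExteriorAlgebra.ιMulti ℂ N w) = (Matrix.of w).det := by
  let e := Pi.basisFun ℂ (Fin N)
  let f : (Fin N → ℂ) [⋀^Fin N]→ₗ[ℂ] ℂ :=
    (e.ExteriorAlgebra.coord Finset.univ).compAlternatingMap (ExteriorAlgebra.ιMulti ℂ N)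
  have hcard : (Finset.univ : Finset (Fin N)).card = N := Finset.card_fin N
  have he : f e = 1 := by
    have h : ExteriorAlgebra.ιMulti ℂ N e = e.ExteriorAlgebra Finset.univ := by
      rw [ExteriorAlgebra.basis_apply_ofCard e hcard, ExteriorAlgebra.ιMulti_family]
      congr 1
      funext i
      have : Finset.orderEmbOfFin Finset.univ hcard = RelEmbedding.refl _ :=
        (Finset.orderEmbOfFin_unique' hcard fun _ => Finset.mem_univ _).symm
      rw [Function.comp_apply, Set.powersetCard.ofFinEmbEquiv_symm_apply]
      exact congrArg e (DFunLike.congr_fun this i).symm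
    simp [f, h]
  have hf := congrArg (fun g => g w) (f.eq_smul_basis_det e)
  rw [he, one_smul] at hf
  refine hf.trans ?_
  rw [Module.Basis.det_apply, ← Matrix.det_transpose]
  rfl

theorem prod_ιMulti_eq_ιMulti {M : Type*} [AddCommGroup M] [Module ℂ M] (L K : ℕ)
    (w : ℕ → ℕ → M) (hL : 0 < L) :
    (List.ofFn fun i : Fin K => ExteriorAlgebra.ιMulti ℂ L fun l : Fin L => w i l).prod =
      ExteriorAlgebra.ιMulti ℂ (L * K) fun r : Fin (L * K) => w (r / L) (r % L) := by
  simp only [ExteriorAlgebra.ιMulti_apply]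
  rw [List.ofFn_mul', List.prod_flatten, List.map_ofFn]
  congr 2
  funext i
  simp only [Function.comp_apply]
  congr 2
  funext l
  rw [Nat.mul_add_div hL, Nat.div_eq_of_lt l.2, add_zero, Nat.mul_add_mod, Nat.mod_eq_of_lt l.2]

/-- The coefficient of the volume form in a product of `K` elements of the exterior algebra. -/
noncomputable def volumeCoeffProd (N K : ℕ) :
    MultilinearMap ℂ (fun _ : Fin K => ExteriorAlgebra ℂ (Fin N → ℂ)) ℂ :=
  ((Pi.basisFun ℂ (Fin N)).ExteriorAlgebra.coord Finset.univ).compMultilinearMap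
    (MultilinearMap.mkPiAlgebraFin ℂ K _)

theorem volumeCoeffProd_apply {N K : ℕ} (α : Fin K → ExteriorAlgebra ℂ (Fin N → ℂ)) :
    volumeCoeffProd N K α = volumeCoeff (List.ofFn α).prod :=
  rfl

theorem hyperpfaffian_eq (L K : ℕ) (ω : ⋀[ℂ]^L (Fin (L * K) → ℂ)) :
    hyperpfaffian L K ω = (K ! : ℂ)⁻¹ * volumeCoeffProd (L * K) K fun _ => ω := by
  rw [volumeCoeffProd_apply, hyperpfaffian, volumeCoeff, map_smul, Finsupp.smul_apply, smul_eq_mul,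
    List.ofFn_const, List.prod_replicate]
  rfl

theorem hyperpfaffian_smul (L K : ℕ) (c : ℂ) (ω : ⋀[ℂ]^L (Fin (L * K) → ℂ)) :
    hyperpfaffian L K (c • ω) = c ^ K * hyperpfaffian L K ω := by
  rw [hyperpfaffian_eq, hyperpfaffian_eq, mul_left_comm]
  congr 1
  have := (volumeCoeffProd (L * K) K).map_smul_univ (fun _ => c) fun _ => ω
  simpa using this

theorem volumeCoeffProd_osculating {L : ℕ} (hL : 0 < L) (K : ℕ) (x : Fin K → ℂ) :
    volumeCoeffProd (L * K) K (fun i => ∑ u : Set.powersetCard (Fin (L * K)) L,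
        x i ^ excess u • normVandermonde u • (basisBlade u : ExteriorAlgebra ℂ (Fin (L * K) → ℂ))) =
      ∏ i, ∏ j ∈ Finset.Ioi i, (x j - x i) ^ L ^ 2 := by
  -- The determinant formula indexes nodes by ℕ; the default 0 is never used as a node.
  let x' : ℕ → ℂ := fun i => if h : i < K then x ⟨i, h⟩ else 0
  have hx' : ∀ i : Fin K, x' i = x i := fun i => dif_pos i.2
  have h1 : ∀ i : Fin K, ∑ u : Set.powersetCard (Fin (L * K)) L, x i ^ excess u •
      normVandermonde u • (basisBlade u : ExteriorAlgebra ℂ (Fin (L * K) → ℂ)) =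
      ExteriorAlgebra.ιMulti ℂ L fun l : Fin L => osculatingVector (L * K) (x' i) l := fun i => by
    have := congrArg Subtype.val (ιMulti_osculatingVector (L * K) L (x i))
    rw [hx', ← exteriorPower.ιMulti_apply_coe, this]
    simp
  simp only [h1]
  rw [volumeCoeffProd_apply, prod_ιMulti_eq_ιMulti L K
    (fun i l => osculatingVector (L * K) (x' i) l) hL, volumeCoeff_ιMulti]
  refine (det_confluentVandermonde hL K x').trans ?_
  rw [Finset.prod_range]
  rw [Finset.prod_comm' (t' := Finset.univ) (s' := fun i => Finset.Iio i) (by simp)]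
  refine Finset.prod_congr rfl fun k _ => ?_
  rw [← Nat.Iio_eq_range, ← Fin.map_valEmbedding_Iio, Finset.prod_map]
  simp [hx']

end Wedge

/-! ### Coefficient extraction through multilinear maps. -/

section Coefficients

open MvPolynomial

variable {σ R : Type*} [Fintype σ] [CommSemiring R]

theorem coeff_prod_aeval_X (h : σ → Polynomial R) (m : σ →₀ ℕ) :
    coeff m (∏ i, Polynomial.aeval (X i : MvPolynomial σ R) (h i)) = ∏ i, (h i).coeff (m i) := by
  classical
  obtain ⟨D, hD⟩ : ∃ D : ℕ, ∀ i, (h i).natDegree < D ∧ m i < D :=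
    ⟨∑ i, ((h i).natDegree + m i + 1), fun i => by
      have := Finset.single_le_sum (f := fun i => (h i).natDegree + m i + 1)
        (fun _ _ => Nat.zero_le _) (Finset.mem_univ i)
      omega⟩
  have h1 : ∀ i, Polynomial.aeval (X i : MvPolynomial σ R) (h i) =
      ∑ n ∈ Finset.range D, monomial (Finsupp.single i n) ((h i).coeff n) := fun i => by
    rw [Polynomial.aeval_eq_sum_range' (hD i).1]
    refine Finset.sum_congr rfl fun n _ => ?_
    rw [X_pow_eq_monomial, smul_monomial, smul_eq_mul, mul_one]
  have h2 : ∀ p : σ → ℕ, ∏ i, monomial (Finsupp.single i (p i)) ((h i).coeff (p i)) =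
      monomial (Finsupp.equivFunOnFinite.symm p) (∏ i, (h i).coeff (p i)) := fun p => by
    rw [Finsupp.equivFunOnFinite_symm_eq_sum, monomial_sum_index, map_prod,
      ← Finset.prod_mul_distrib]
    exact Finset.prod_congr rfl fun i _ => by rw [C_mul_monomial, mul_one]
  simp only [h1]
  rw [Finset.prod_univ_sum, coeff_sum, Finset.sum_eq_single (m : σ → ℕ)]
  · rw [h2, coeff_monomial, if_pos (by ext; rfl)]
  · intro p _ hp
    rw [h2, coeff_monomial, if_neg]
    rintro rfl
    exact hp rfl
  · intro hm
    exact absurd (Fintype.mem_piFinset.2 fun i => Finset.mem_range.2 (hD i).2) hm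

/-- Applying a multilinear map to a vector whose coordinates are coefficients of `X ^ s u * g`
extracts a coefficient of the polynomial that interpolates the map on the moment vectors. -/
theorem multilinearMap_coeff_eq {V U F : Type*} [Field F] [Infinite F] [AddCommGroup V] [Module F V]
    [Fintype U] (T : MultilinearMap F (fun _ : σ => V) F) (E : U → V) (s : U → ℕ)
    (P : MvPolynomial σ F)
    (hP : ∀ x : σ → F, T (fun i => ∑ u, x i ^ s u • E u) = eval x P)
    (g : Polynomial F) (m : σ →₀ ℕ) :
    T (fun i => ∑ u, (Polynomial.X ^ s u * g).coeff (m i) • E u) =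
      coeff m (P * ∏ i, Polynomial.aeval (X i) g) := by
  classical
  -- Over an infinite field, agreement at all points is equality of polynomials.
  have hexp : P = ∑ p : σ → U, C (T fun i => E (p i)) * ∏ i, X i ^ s (p i) := by
    refine MvPolynomial.funext fun x => ?_
    rw [← hP, T.map_sum, map_sum]
    refine Finset.sum_congr rfl fun p _ => ?_
    rw [T.map_smul_univ (fun i => x i ^ s (p i)) fun i => E (p i), map_mul, eval_C, map_prod,
      smul_eq_mul, mul_comm]
    simp
  rw [hexp, T.map_sum, Finset.sum_mul, coeff_sum]
  refine Finset.sum_congr rfl fun p _ => ?_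
  refine (T.map_smul_univ (fun i => (Polynomial.X ^ s (p i) * g).coeff (m i))
    fun i => E (p i)).trans ?_
  rw [smul_eq_mul, mul_assoc, coeff_C_mul, ← Finset.prod_mul_distrib, mul_comm,
    ← coeff_prod_aeval_X fun i => Polynomial.X ^ s (p i) * g]
  simp

end Coefficients

/-! ### The Dyson coefficient with one variable specialised. -/

section DysonVandermonde

open MvPolynomial

theorem dysonPoly_univ_const (n k : ℕ) (hk : Even k) :
    dysonPoly ℂ (Finset.univ : Finset (Fin n)) (fun _ => k) =
      ∏ i : Fin n, ∏ j ∈ Finset.Ioi i, (X j - X i) ^ (2 * k) := by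
  have h := Finset.prod_prod_Ioi_mul_eq_prod_prod_off_diag
    fun i j : Fin n => (X i - X j : MvPolynomial (Fin n) ℂ) ^ k
  rw [dysonPoly]
  simp only [← Finset.prod_pow, ← Finset.compl_singleton]
  rw [← h]
  refine Finset.prod_congr rfl fun i _ => Finset.prod_congr rfl fun j _ => ?_
  rw [← neg_sub (X j), hk.neg_pow, ← pow_add, two_mul]

/-- The extra factor turns the product into a Dyson product in K + 1 variables, with the zeroth one
evaluated at y. -/
theorem coeff_vandermonde_pow_mul (K k : ℕ) (hk : Even k) (y : ℂ) (m : Fin K →₀ ℕ)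
    (hm : ∀ i, m i = K * k) :
    coeff m ((∏ i : Fin K, ∏ j ∈ Finset.Ioi i, (X j - X i) ^ (2 * k)) *
        ∏ i, (X i - C y) ^ (2 * k)) =
      y ^ (K * k) * (Nat.multinomial Finset.univ (fun _ : Fin (K + 1) => k) : ℂ) := by
  set G := dysonPoly ℂ (Finset.univ : Finset (Fin (K + 1))) (fun _ => k) with hG
  have hGeval : ((∏ i : Fin K, ∏ j ∈ Finset.Ioi i, (X j - X i) ^ (2 * k)) *
      ∏ i, (X i - C y) ^ (2 * k) : MvPolynomial (Fin K) ℂ) =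
      (finSuccEquiv ℂ K G).eval (C y) := by
    rw [hG, dysonPoly_univ_const _ _ hk, Fin.prod_univ_succ]
    simp only [Fin.prod_Ioi_zero, Fin.prod_Ioi_succ, map_mul, map_prod, map_pow, map_sub,
      finSuccEquiv_X_zero, finSuccEquiv_X_succ, Polynomial.eval_mul, Polynomial.eval_prod,
      Polynomial.eval_pow, Polynomial.eval_sub, Polynomial.eval_X, Polynomial.eval_C]
    rw [mul_comm]
  have hGhom : ∃ d, G.IsHomogeneous d :=
    ⟨_, IsHomogeneous.prod _ _ _ fun j _ => (IsHomogeneous.prod _ _ _ fun i _ =>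
      (isHomogeneous_X ℂ i).sub (isHomogeneous_X ℂ j)).pow _⟩
  obtain ⟨d, hd⟩ := hGhom
  have hdyson := coeff_dysonPoly_mul_prod_factorial (R := ℂ) Finset.univ (fun _ => k)
    (m.cons (K * k)) (fun i => by
      refine Fin.cases ?_ (fun i => ?_) i <;> simp [hm])
  have hmult := congrArg (Nat.cast : ℕ → ℂ)
    (Nat.multinomial_spec Finset.univ fun _ : Fin (K + 1) => k)
  have hcoeff : coeff (m.cons (K * k)) G =
      (Nat.multinomial Finset.univ (fun _ : Fin (K + 1) => k) : ℂ) := by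
    rw [← hmult, Nat.cast_mul, Nat.cast_prod, mul_comm] at hdyson
    exact mul_left_cancel₀ (Finset.prod_ne_zero_iff.2 fun i _ =>
      Nat.cast_ne_zero.2 (Nat.factorial_ne_zero _)) hdyson
  -- Nonvanishing pins the degree of the homogeneous polynomial `G`, so no other power of y can
  -- accompany m.
  have hne : coeff (m.cons (K * k)) G ≠ 0 := by
    rw [hcoeff]
    intro h0
    rw [Nat.cast_mul, h0, mul_zero] at hmult
    exact Nat.cast_ne_zero.2 (Nat.factorial_ne_zero _) hmult.symm
  have hother : ∀ i, i ≠ K * k → coeff (m.cons i) G = 0 := fun i hi => by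
    by_contra h
    have h1 := not_not.1 (mt hd.coeff_eq_zero h)
    have h2 := not_not.1 (mt hd.coeff_eq_zero hne)
    rw [Finsupp.degree_eq_sum, Fin.sum_univ_succ] at h1 h2
    simp only [Finsupp.cons_zero, Finsupp.cons_succ] at h1 h2
    omega
  rw [hGeval, Polynomial.eval_eq_sum, Polynomial.sum_def, coeff_sum]
  have hterm : ∀ i, coeff m ((finSuccEquiv ℂ K G).coeff i * C y ^ i) =
      y ^ i * coeff (m.cons i) G := fun i => by
    rw [← map_pow, mul_comm, coeff_C_mul, finSuccEquiv_coeff_coeff]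
  simp only [hterm]
  rw [Finset.sum_eq_single (K * k) (fun i _ hi => by rw [hother i hi, mul_zero]), hcoeff]
  intro h
  rw [Polynomial.notMem_support_iff] at h
  rw [← finSuccEquiv_coeff_coeff, h, coeff_zero, mul_zero]

end DysonVandermonde
-- Matching the weights and conclusion.
section MainTheorem

theorem excess_add_eq_indexSum {N L : ℕ} (t : Set.powersetCard (Fin N) L) :
    (excess t : ℤ) + ((∑ l : Fin L, (l : ℕ) : ℕ) : ℤ) = indexSum t := by
  have hle : ∑ l : Fin L, (l : ℕ) ≤ ∑ k : Fin L, (Set.powersetCard.ofFinEmbEquiv.symm t k : ℕ) := by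
    have hk : ∀ n (hn : n < L), n ≤ (Set.powersetCard.ofFinEmbEquiv.symm t ⟨n, hn⟩ : ℕ) := by
      intro n
      induction n with
      | zero => exact fun _ => Nat.zero_le _
      | succ n ih =>
        intro hn
        have h : (⟨n, by omega⟩ : Fin L) < ⟨n + 1, hn⟩ := Nat.lt_succ_self n
        exact (ih (by omega)).trans_lt ((Set.powersetCard.ofFinEmbEquiv.symm t).strictMono h)
    exact Finset.sum_le_sum fun k _ => hk k k.2
  rw [excess, indexSum, Nat.cast_sub hle]
  push_cast
  ring

theorem centredSum_add_eq {L : ℕ} (hLe : Even L) (K : ℕ) (t : Set.powersetCard (Fin (L * K)) L) :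
    centredSum t + ((L ^ 2 / 2 : ℕ) : ℤ) =
      excess t + ((L ^ 2 : ℕ) : ℤ) - ((K * (L ^ 2 / 2) : ℕ) : ℤ) := by
  obtain ⟨h, rfl⟩ := hLe
  have hsum : (∑ l : Fin (h + h), (l : ℕ)) * 2 = (h + h) * (h + h - 1) := by
    rw [Fin.sum_univ_eq_sum_range fun l => l, Finset.sum_range_id_mul_two]
  have hsum' : ((∑ l : Fin (h + h), (l : ℕ) : ℕ) : ℤ) = h * (2 * h - 1) := by
    rcases Nat.eq_zero_or_pos h with rfl | hh
    · simp
    · zify [show 1 ≤ h + h by omega] at hsum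
      push_cast
      linarith
  have h1 := excess_add_eq_indexSum t
  have hdiv : ((h + h : ℕ) : ℤ) * (((h + h) * K : ℕ) - 1) / 2 = h * (2 * h * K - 1) := by
    refine Int.ediv_eq_of_eq_mul_left two_ne_zero ?_
    push_cast
    ring
  have hsq : (h + h) ^ 2 / 2 = 2 * h ^ 2 := by
    rw [show (h + h) ^ 2 = 2 * h ^ 2 * 2 by ring, Nat.mul_div_cancel _ two_pos]
  rw [centredSum, hdiv, ← h1, hsum', hsq]
  push_cast
  ring

/-- By hd, d + b is the exponent of -y in the relevant binomial term, and |d| ≤ b says that this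
exponent lies between 0 and 2b. -/
theorem coeff_X_pow_mul_X_sub_C_pow (y : ℂ) (s b n : ℕ) (d : ℤ) (hd : d + b = s + (2 * b : ℕ) - n) :
    (Polynomial.X ^ s * (Polynomial.X - Polynomial.C y) ^ (2 * b)).coeff n =
      if |d| ≤ b then ((2 * b).choose (d + b).toNat : ℂ) * (-y) ^ (d + b) else 0 := by
  rw [Polynomial.coeff_X_pow_mul', sub_eq_add_neg, ← Polynomial.C_neg,
    Polynomial.coeff_X_add_C_pow]
  by_cases h : |d| ≤ b
  · obtain ⟨h1, h2⟩ := abs_le.1 h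
    obtain ⟨e, he⟩ := Int.eq_ofNat_of_zero_le (show 0 ≤ d + b by omega)
    rw [if_pos h, if_pos (by omega), he, Int.toNat_natCast, zpow_natCast,
      show 2 * b - (n - s) = e by omega, mul_comm, ← Nat.choose_symm (show e ≤ 2 * b by omega),
      show 2 * b - e = n - s by omega]
  · rw [if_neg h, ite_eq_right_iff]
    intro hs
    rw [Nat.choose_eq_zero_of_lt, Nat.cast_zero, mul_zero]
    by_contra h'
    exact h (abs_le.2 (by omega))

theorem hyperpfaffian_shifted {L : ℕ} (hL : 0 < L) (hLe : Even L) (K : ℕ) (y : ℂ) :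
    hyperpfaffian L K
        (∑ u : Set.powersetCard (Fin (L * K)) L with |centredSum u| ≤ ((L ^ 2 / 2 : ℕ) : ℤ),
          (((L ^ 2).choose (centredSum u + ((L ^ 2 / 2 : ℕ) : ℤ)).toNat : ℂ) *
              (-y) ^ (centredSum u + ((L ^ 2 / 2 : ℕ) : ℤ)) * normVandermonde u) • basisBlade u) =
      (K ! : ℂ)⁻¹ * (y ^ (K * (L ^ 2 / 2)) *
        (Nat.multinomial Finset.univ (fun _ : Fin (K + 1) => L ^ 2 / 2) : ℂ)) := by
  have h4 : 4 ∣ L ^ 2 := by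
    obtain ⟨h, rfl⟩ := hLe
    exact ⟨h ^ 2, by ring⟩
  have hb : L ^ 2 = 2 * (L ^ 2 / 2) := by omega
  have hbe : Even (L ^ 2 / 2) := Nat.even_iff.2 (by omega)
  rw [hyperpfaffian_eq]
  congr 1
  -- In Dyson's identity with K + 1 exponents β/2, each variable has target exponent Kβ/2: one β/2
  -- for each other variable.
  let m : Fin K →₀ ℕ := Finsupp.equivFunOnFinite.symm fun _ => K * (L ^ 2 / 2)
  have key := multilinearMap_coeff_eq (volumeCoeffProd (L * K) K)
    (fun u : Set.powersetCard (Fin (L * K)) L =>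
      normVandermonde u • (basisBlade u : ExteriorAlgebra ℂ (Fin (L * K) → ℂ))) excess
    (∏ i, ∏ j ∈ Finset.Ioi i, (MvPolynomial.X j - MvPolynomial.X i) ^ L ^ 2)
    (fun x => by rw [volumeCoeffProd_osculating hL]; simp)
    ((Polynomial.X - Polynomial.C y) ^ L ^ 2) m
  have hdyson := coeff_vandermonde_pow_mul K (L ^ 2 / 2) hbe y m fun _ => rfl
  rw [← hdyson, ← hb]
  simp only [map_pow, map_sub, Polynomial.aeval_X, Polynomial.aeval_C,
    MvPolynomial.algebraMap_eq] at key
  rw [← key]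
  congr 1
  funext i
  rw [AddSubmonoidClass.coe_finsetSum, Finset.sum_filter]
  refine Finset.sum_congr rfl fun u _ => ?_
  have hc := coeff_X_pow_mul_X_sub_C_pow y (excess u) (L ^ 2 / 2) (K * (L ^ 2 / 2)) (centredSum u)
    (by rw [centredSum_add_eq hLe, ← hb])
  rw [← hb] at hc
  rw [show m i = K * (L ^ 2 / 2) from rfl, hc]
  split_ifs
  · rw [smul_smul]
    rfl
  · rw [zero_smul]

end MainTheorem

theorem mainTheorem5 (L M : ℕ) (hL : 0 < L) (hLe : Even L) (hM : 1 ≤ M) (y : ℂ) (hy : y ≠ 0) :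
    hyperpfaffian L (M - 1)
        (∑ u : Set.powersetCard (Fin (L * (M - 1))) L with
            |centredSum u| ≤ ((L ^ 2 / 2 : ℕ) : ℤ),
          (((L ^ 2).choose (centredSum u + ((L ^ 2 / 2 : ℕ) : ℤ)).toNat : ℂ) *
              (-y) ^ (centredSum u) * normVandermonde u) • basisBlade u)
      = 1 / ((M - 1)! : ℂ) *
          (Nat.multinomial Finset.univ (fun _ : Fin M => L ^ 2 / 2) : ℂ) ∧
    hyperpfaffian L (M - 1)
        (∑ u : Set.powersetCard (Fin (L * (M - 1))) L with
            |centredSum u| ≤ ((L ^ 2 / 2 : ℕ) : ℤ),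
          (((L ^ 2).choose (centredSum u + ((L ^ 2 / 2 : ℕ) : ℤ)).toNat : ℂ) *
              (-y) ^ (centredSum u + ((L ^ 2 / 2 : ℕ) : ℤ)) * normVandermonde u) • basisBlade u)
      = 1 / ((M - 1)! : ℂ) *
          (Nat.multinomial Finset.univ (fun _ : Fin M => L ^ 2 / 2) : ℂ) *
          y ^ (L ^ 2 * (M - 1) / 2) := by

  generalize hK : M - 1 = K
  obtain rfl : M = K + 1 := by omega
  have h4 : 4 ∣ L ^ 2 := by
    obtain ⟨h, rfl⟩ := hLe
    exact ⟨h ^ 2, by ring⟩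
  have hbe : Even (L ^ 2 / 2) := Nat.even_iff.2 (by omega)
  have hpow : L ^ 2 * K / 2 = K * (L ^ 2 / 2) := by
    rw [Nat.mul_comm, Nat.mul_div_assoc _ (by omega)]
  have hmain := hyperpfaffian_shifted hL hLe K y
  refine ⟨?_, ?_⟩
  -- The two normalisations differ by the scalar (-y)^(β/2), whose sign disappears because 4 ∣ L²
  -- makes β/2 even.
  · have hscale : ∀ u : Set.powersetCard (Fin (L * K)) L,
        (((L ^ 2).choose (centredSum u + ((L ^ 2 / 2 : ℕ) : ℤ)).toNat : ℂ) *
          (-y) ^ centredSum u * normVandermonde u) • basisBlade u =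
        ((-y) ^ (L ^ 2 / 2))⁻¹ •
          (((L ^ 2).choose (centredSum u + ((L ^ 2 / 2 : ℕ) : ℤ)).toNat : ℂ) *
            (-y) ^ (centredSum u + ((L ^ 2 / 2 : ℕ) : ℤ)) * normVandermonde u) • basisBlade u :=
      fun u => by
        rw [smul_smul, zpow_add₀ (neg_ne_zero.2 hy), zpow_natCast]
        congr 1
        have := pow_ne_zero (L ^ 2 / 2) (neg_ne_zero.2 hy)
        field_simp
    simp only [hscale]
    rw [← Finset.smul_sum, hyperpfaffian_smul, hmain, hbe.neg_pow, inv_pow, ← pow_mul,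
      mul_comm (L ^ 2 / 2) K]
    have := pow_ne_zero (K * (L ^ 2 / 2)) hy
    field_simp
  · rw [hmain, hpow]
    ring
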